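/- Let $\widehat D_1=\mathbb C[[x]]\otimes_{\mathbb C[x]}D_1$ be the completed first Weyl algebra, i.e. the ring of differential operators $\sum_i a_i\partial^i$ (finite sums) with $a_i\in\mathbb C[[x]]$, acting on $\mathbb C((x))$, and for $k\in\mathbb Z$ let $$V_k\widehat D_1=\{P\in\widehat D_1 : P(\mathbb C[[x]]x^p)\subseteq \mathbb C[[x]]x^{p-k}\text{ for all }p\in\mathbb Z\}.$$ Let $M$ be a holonomic left $\widehat D_1$-module, i.e. $M$ is finitely generated and, for a good filtration with respect to the order filtration of $\widehat D_1$, its characteristic variety (the zero set of the annihilator of the associated graded module in $\mathbb C[[x]][\xi]$) has dimension at most $1$. Suppose that $M$ is regular, i.e. that the formal meromorphic connection $M[x^{-1}]=\mathbb C((x))\otimes_{\mathbb C[[x]]}M$, with $\partial(f\otimes m)=f'\otimes m+f\otimes\partial m$, contains a finitely generated $\mathbb C[[x]]$-submodule that spans it over $\mathbb C((x))$ and is stable under $x\partial$. Let $U_\bullet M$ be any good filtration of $M$ with respect to $V_\bullet\widehat D_1$, i.e. an increasing exhaustive filtration $(U_kM)_{k\in\mathbb Z}$ with $V_i\widehat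 D_1\cdot U_jM\subseteq U_{i+j}M$ for which there are $m_1,\dots,m_s\in M$ and $k_1,\dots,k_s\in\mathbb Z$ such that $$U_pM=V_{p-k_1}\widehat D_1\cdot m_1+\dots+V_{p-k_s}\widehat D_1\cdot m_s\qquad\text{for all }p\in\mathbb Z$$ (it need not be the canonical $V$-filtration). Regard $\mathrm{gr}^U M=\bigoplus_k U_kM/U_{k-1}M$ as a module over $\mathbb C[x]\subseteq D_1\cong\mathrm{gr}^V\widehat D_1$, where $x$ acts through its class in $V_{-1}\widehat D_1/V_{-2}\widehat D_1$. Then $$\operatorname{rank}(\mathrm{gr}^U M)=\operatorname{rank}(M),$$ where $\operatorname{rank}(M)=\dim_{\mathbb C((x))}\big(\mathbb C((x))\otimes_{\mathbb C[[x]]}M\big)$ and $\operatorname{rank}(\mathrm{gr}^U M)=\dim_{\mathbb C(x)}\big(\mathbb C(x)\otimes_{\mathbb C[x]}\mathrm{gr}^U M\big)$. -/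

import Mathlib

open scoped PowerSeries LaurentSeries Polynomial TensorProduct

noncomputable section

universe u v

namespace FormalWeyl

variable {K : Type u} [Field K]

/-! Everything is defined over a field `K`; the case of interest is `K = ℂ`. -/

/-! ## Laurent series -/

/-- `xPow p` is the subspace `K[[x]] x ^ p` of `K((x))`: all series without terms of degree `< p`. -/
def xPow (p : ℤ) : Submodule K K⸨X⸩ where
  carrier := {f | ∀ n < p, f.coeff n = 0}
  zero_mem' := by intro n _; simp
  add_mem' := by
    intro f g hf hg n hn
    simp [hf n hn, hg n hn]
  smul_mem' := by
    intro c f hf n hn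
    simp [hf n hn]

theorem mem_xPow {p : ℤ} {f : K⸨X⸩} : f ∈ xPow p ↔ ∀ n < p, f.coeff n = 0 := Iff.rfl

theorem mul_mem_xPow {p q : ℤ} {f g : K⸨X⸩} (hf : f ∈ xPow p) (hg : g ∈ xPow q) :
    f * g ∈ xPow (p + q) := by
  intro n hn
  rw [HahnSeries.coeff_mul]
  refine Finset.sum_eq_zero fun ij hij => ?_
  rw [Finset.mem_antidiagonal] at hij
  by_cases h : ij.1 < p
  · rw [hf _ h, zero_mul]
  · rw [hg ij.2 (by omega), mul_zero]

theorem coe_mem_xPow (f : K⟦X⟧) : (f : K⸨X⸩) ∈ xPow 0 := by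
  intro n hn
  rw [HahnSeries.ofPowerSeries_apply, HahnSeries.embDomain_of_notMem_range]
  rintro ⟨m, hm⟩
  simp at hm
  omega

theorem coe_X_mem_xPow : ((PowerSeries.X : K⟦X⟧) : K⸨X⸩) ∈ xPow 1 := by
  intro n hn
  rw [HahnSeries.ofPowerSeries_X, HahnSeries.coeff_single_of_ne (by omega)]

/-- The derivation `d/dx` of `K((x))`. -/
abbrev ddx : Module.End K K⸨X⸩ := LaurentSeries.derivative K

theorem coeff_ddx (f : K⸨X⸩) (n : ℤ) : (ddx f).coeff n = ((n : K) + 1) * f.coeff (n + 1) := by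
  simp [ddx, LaurentSeries.hasseDeriv_coeff, add_mul]

theorem ddx_mul (f g : K⸨X⸩) : ddx (f * g) = ddx f * g + f * ddx g := by
  -- multiply by `x`, so that the Euler operator can be compared degree by degree
  have euler : ∀ (h : K⸨X⸩) (n : ℤ),
      (HahnSeries.single (1 : ℤ) (1 : K) * ddx h).coeff n = (n : K) * h.coeff n := by
    intro h n
    have := HahnSeries.coeff_single_mul_add (r := (1 : K)) (x := ddx h) (a := n - 1) (b := 1)
    rw [sub_add_cancel] at this
    rw [this, coeff_ddx]
    simp
  have supp : ∀ h : K⸨X⸩, (HahnSeries.single (1 : ℤ) (1 : K) * ddx h).support ⊆ h.support := by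
    intro h m hm
    rw [HahnSeries.mem_support, euler] at hm
    rw [HahnSeries.mem_support]
    exact right_ne_zero_of_mul hm
  have key : HahnSeries.single (1 : ℤ) (1 : K) * ddx (f * g) =
      HahnSeries.single (1 : ℤ) (1 : K) * (ddx f * g + f * ddx g) := by
    rw [mul_add, ← mul_assoc, mul_left_comm _ f]
    ext n
    have h1 := HahnSeries.coeff_mul_left' (x := HahnSeries.single (1 : ℤ) (1 : K) * ddx f)
      (y := g) (a := n) f.isPWO_support (supp f)
    have h2 := HahnSeries.coeff_mul_right' (x := f)
      (y := HahnSeries.single (1 : ℤ) (1 : K) * ddx g) (a := n) g.isPWO_support (supp g)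
    rw [euler, HahnSeries.coeff_add, h1, h2, HahnSeries.coeff_mul, Finset.mul_sum]
    rw [← Finset.sum_add_distrib]
    refine Finset.sum_congr rfl fun ij hij => ?_
    rw [Finset.mem_antidiagonal] at hij
    rw [euler, euler, ← hij.2.2]
    push_cast
    ring
  exact mul_left_cancel₀ (by simp) key

theorem ddx_coe (f : K⟦X⟧) : ddx (f : K⸨X⸩) = (PowerSeries.derivative K f : K⟦X⟧) := by
  ext n
  rw [coeff_ddx]
  obtain ⟨m, rfl⟩ | hn : (∃ m : ℕ, n = m) ∨ n < 0 := by
    rcases lt_or_ge n 0 with h | h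
    · exact Or.inr h
    · exact Or.inl ⟨n.toNat, by omega⟩
  · have h : ((m : ℤ) + 1) = ((m + 1 : ℕ) : ℤ) := by push_cast; rfl
    rw [h, LaurentSeries.coeff_coe_powerSeries, LaurentSeries.coeff_coe_powerSeries,
      PowerSeries.coeff_derivative]
    push_cast
    ring
  · rw [coe_mem_xPow _ n hn]
    rcases eq_or_lt_of_le (show n ≤ -1 by omega) with rfl | h
    · simp
    · rw [coe_mem_xPow _ (n + 1) (by omega), mul_zero]

/-! ## The completed Weyl algebra -/

/-- Multiplication by `f ∈ K[[x]]` as an operator on `K((x))`. -/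
def mulOp (f : K⟦X⟧) : Module.End K K⸨X⸩ where
  toFun h := (f : K⸨X⸩) * h
  map_add' g h := mul_add _ g h
  map_smul' c h := by
    rw [RingHom.id_apply, ← HahnSeries.C_mul_eq_smul, ← HahnSeries.C_mul_eq_smul, mul_left_comm]

/-- The algebra of operators on `K((x))` generated by the multiplications by elements of `K[[x]]`
and by `d/dx`. -/
def weylSubalgebra (K : Type u) [Field K] : Subalgebra K (Module.End K K⸨X⸩) :=
  Algebra.adjoin K (Set.range mulOp ∪ {ddx})

/-- The completed first Weyl algebra `D̂₁ = K[[x]] ⊗_{K[x]} D₁ = K[[x]]⟨∂⟩`, realised as the ring of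
differential operators `∑ aᵢ ∂ ^ i` with coefficients `aᵢ ∈ K[[x]]` acting on `K((x))`. (This action
is faithful when `K` has characteristic zero.) -/
def WeylHat (K : Type u) [Field K] : Type u := weylSubalgebra K

instance : Ring (WeylHat K) := inferInstanceAs (Ring (weylSubalgebra K))

instance : Algebra K (WeylHat K) :=
  inferInstanceAs (Algebra K (weylSubalgebra K))

namespace WeylHat

/-- The action of an operator `P ∈ D̂₁` on `K((x))`. -/
def op : WeylHat K →ₐ[K] Module.End K K⸨X⸩ := (weylSubalgebra K).val

theorem op_injective : Function.Injective (op (K := K)) := Subtype.val_injective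

/-- The inclusion `K[[x]] ⊆ D̂₁`. -/
def coeffHom : K⟦X⟧ →+* WeylHat K where
  toFun f := ⟨mulOp f, Algebra.subset_adjoin (Or.inl ⟨f, rfl⟩)⟩
  map_one' := by
    apply op_injective
    apply LinearMap.ext
    intro h
    change ((1 : K⟦X⟧) : K⸨X⸩) * h = h
    simp
  map_mul' f g := by
    apply op_injective
    apply LinearMap.ext
    intro h
    change ((f * g : K⟦X⟧) : K⸨X⸩) * h = (f : K⸨X⸩) * ((g : K⸨X⸩) * h)
    rw [map_mul, mul_assoc]
  map_zero' := by
    apply op_injective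
    apply LinearMap.ext
    intro h
    change ((0 : K⟦X⟧) : K⸨X⸩) * h = 0
    simp
  map_add' f g := by
    apply op_injective
    apply LinearMap.ext
    intro h
    change ((f + g : K⟦X⟧) : K⸨X⸩) * h = (f : K⸨X⸩) * h + (g : K⸨X⸩) * h
    rw [map_add, add_mul]

@[simp] theorem op_coeffHom (f : K⟦X⟧) (h : K⸨X⸩) : op (coeffHom f) h = (f : K⸨X⸩) * h := rfl

variable (K) in
/-- The element `∂ ∈ D̂₁`. -/
def del : WeylHat K := ⟨ddx, Algebra.subset_adjoin (Or.inr rfl)⟩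

@[simp] theorem op_del (h : K⸨X⸩) : op (del K) h = ddx h := rfl

theorem del_mul_coeffHom (f : K⟦X⟧) :
    del K * coeffHom f = coeffHom f * del K + coeffHom (PowerSeries.derivative K f) := by
  apply op_injective
  apply LinearMap.ext
  intro h
  rw [map_mul, map_add, map_mul]
  simp only [Module.End.mul_apply, LinearMap.add_apply, op_coeffHom, op_del]
  rw [ddx_mul, ddx_coe, add_comm]

end WeylHat

open WeylHat

/-- Every left `D̂₁`-module is a `K[[x]]`-module by restriction of scalars. In particular `D̂₁` is a
`K[[x]]`-module by left multiplication. -/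
instance instPowerSeriesModule {M : Type v} [AddCommMonoid M] [Module (WeylHat K) M] : Module K⟦X⟧ M :=
  Module.compHom M coeffHom

theorem powerSeries_smul_def {M : Type v} [AddCommMonoid M] [Module (WeylHat K) M] (f : K⟦X⟧) (m : M) :
    f • m = coeffHom f • m := rfl

instance {M : Type v} [AddCommMonoid M] [Module (WeylHat K) M] :
    IsScalarTower K⟦X⟧ (WeylHat K) M where
  smul_assoc f P m := by
    rw [powerSeries_smul_def, powerSeries_smul_def, smul_eq_mul, mul_smul]

theorem del_smul_smul {M : Type v} [AddCommGroup M] [Module (WeylHat K) M] (f : K⟦X⟧) (m : M) :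
    del K • f • m = f • del K • m + PowerSeries.derivative K f • m := by
  simp only [powerSeries_smul_def, ← mul_smul, ← add_smul, del_mul_coeffHom]

/-! ## Filtrations of `D̂₁` -/

/-- The `V`-filtration of `D̂₁`: `P ∈ V_k` if and only if `P (K[[x]] x ^ p) ⊆ K[[x]] x ^ (p - k)` for
all `p ∈ ℤ`. -/
def V (K : Type u) [Field K] (k : ℤ) : Submodule K⟦X⟧ (WeylHat K) where
  carrier := {P | ∀ p : ℤ, ∀ f ∈ xPow p, op P f ∈ xPow (p - k)}
  zero_mem' := by
    intro p f _
    rw [map_zero]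
    exact Submodule.zero_mem _
  add_mem' := by
    intro P Q hP hQ p f hf
    rw [map_add]
    exact Submodule.add_mem _ (hP p f hf) (hQ p f hf)
  smul_mem' := by
    intro a P hP p f hf
    have h : op (a • P) f = (a : K⸨X⸩) * op P f := by
      rw [powerSeries_smul_def, smul_eq_mul, map_mul]
      rfl
    rw [h]
    simpa using mul_mem_xPow (coe_mem_xPow a) (hP p f hf)

theorem X_mem_V : coeffHom (PowerSeries.X : K⟦X⟧) ∈ V K (-1) := by
  intro p f hf
  rw [op_coeffHom, sub_neg_eq_add, add_comm]
  exact mul_mem_xPow coe_X_mem_xPow hf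

/-- The filtration of `D̂₁` by the order of differential operators: `F_k` consists of all
`∑_{i ≤ k} aᵢ ∂ ^ i`. -/
def orderFiltration (K : Type u) [Field K] (k : ℤ) : Submodule K⟦X⟧ (WeylHat K) :=
  Submodule.span K⟦X⟧ {P | ∃ i : ℕ, (i : ℤ) ≤ k ∧ P = del K ^ i}

/-! ## Filtered modules -/

/-- An increasing exhaustive filtration of the left `D̂₁`-module `M` which is compatible with the
filtration `F` of the ring `D̂₁`. -/
structure ModuleFiltration (F : ℤ → Submodule K⟦X⟧ (WeylHat K)) (M : Type v) [AddCommGroup M]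
    [Module (WeylHat K) M] where
  /-- The pieces of the filtration. -/
  piece : ℤ → Submodule K⟦X⟧ M
  mono : Monotone piece
  smul_mem : ∀ (i j : ℤ) (P : WeylHat K) (m : M), P ∈ F i → m ∈ piece j → P • m ∈ piece (i + j)
  exhaustive : ∀ m : M, ∃ k : ℤ, m ∈ piece k

namespace ModuleFiltration

variable {F : ℤ → Submodule K⟦X⟧ (WeylHat K)} {M : Type v} [AddCommGroup M] [Module (WeylHat K) M]

/-- The filtration `U` is good if there are `m₁, …, mₛ ∈ M` and `k₁, …, kₛ ∈ ℤ` such that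
`U_p = F_{p - k₁} m₁ + ⋯ + F_{p - kₛ} mₛ` for all `p ∈ ℤ`. -/
def IsGood (U : ModuleFiltration F M) : Prop :=
  ∃ (s : ℕ) (m : Fin s → M) (k : Fin s → ℤ), ∀ p : ℤ,
    U.piece p = ⨆ i, (F (p - k i)).map
      ((LinearMap.toSpanSingleton (WeylHat K) M (m i)).restrictScalars K⟦X⟧)

/-- The graded piece `gr_k M = U_k / U_{k-1}`. -/
def GrPiece (U : ModuleFiltration F M) (k : ℤ) : Type v :=
  U.piece k ⧸ (U.piece (k - 1)).submoduleOf (U.piece k)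

instance (U : ModuleFiltration F M) (k : ℤ) : AddCommGroup (U.GrPiece k) :=
  Submodule.Quotient.addCommGroup ((U.piece (k - 1)).submoduleOf (U.piece k))

instance (U : ModuleFiltration F M) (k : ℤ) : Module K⟦X⟧ (U.GrPiece k) :=
  Submodule.Quotient.module ((U.piece (k - 1)).submoduleOf (U.piece k))

/-- The associated graded module `gr M = ⨁ₖ U_k / U_{k-1}`. -/
def Gr (U : ModuleFiltration F M) : Type v := DirectSum ℤ U.GrPiece

instance (U : ModuleFiltration F M) : AddCommGroup U.Gr :=
  inferInstanceAs (AddCommGroup (DirectSum ℤ U.GrPiece))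

instance (U : ModuleFiltration F M) : Module K⟦X⟧ U.Gr :=
  inferInstanceAs (Module K⟦X⟧ (DirectSum ℤ U.GrPiece))

/-- Multiplication by `x` as a map `U_k → U_{k-1}`. -/
def mulX (U : ModuleFiltration (V K) M) (k : ℤ) : U.piece k →ₗ[K⟦X⟧] U.piece (k - 1) :=
  (LinearMap.lsmul K⟦X⟧ M PowerSeries.X).restrict fun m hm => by
    have h := U.smul_mem (-1) k (coeffHom PowerSeries.X) m X_mem_V hm
    rwa [neg_add_eq_sub] at h

/-- The map `gr_k M → gr_{k-1} M` given by the class of `x` in `V_{-1} / V_{-2}`. -/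
def grMulX (U : ModuleFiltration (V K) M) (k : ℤ) : U.GrPiece k →ₗ[K⟦X⟧] U.GrPiece (k - 1) :=
  Submodule.mapQ _ _ (U.mulX k) fun m hm => (U.mulX (k - 1) ⟨m.1, hm⟩).2

/-- The action of the class of `x` in `gr_{-1} D̂₁ = V_{-1} / V_{-2}` on `gr M`. -/
def grX (U : ModuleFiltration (V K) M) : Module.End K⟦X⟧ U.Gr :=
  DirectSum.toModule K⟦X⟧ ℤ _
    fun k => DirectSum.lof K⟦X⟧ ℤ U.GrPiece (k - 1) ∘ₗ U.grMulX k

/-- The associated graded module for a `V`-filtration, as a module over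
`K[x] ⊆ D₁ ≅ gr^V D̂₁`: constants act in the obvious way and the variable acts through the class
of `x` in `V_{-1} / V_{-2}`. -/
instance (U : ModuleFiltration (V K) M) : Module K[X] U.Gr :=
  Module.compHom U.Gr
    ((Polynomial.aeval U.grX).toRingHom.comp (Polynomial.mapRingHom (PowerSeries.C (R := K))))

/-- The rank `dim_{K(x)} (K(x) ⊗_{K[x]} gr M)` of the associated graded module. -/
def grRank {M : Type v} [AddCommGroup M] [Module (WeylHat K) M] (U : ModuleFiltration (V K) M) : Cardinal :=
  Module.rank (RatFunc K) (RatFunc K ⊗[K[X]] U.Gr)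

/-- For a filtration compatible with the order filtration of `D̂₁`, the annihilator of `gr M` in
`gr^F D̂₁ = K[[x]][ξ]`, where `ξ` is the symbol of `∂`. It is a homogeneous ideal; a homogeneous
element `a ξ ^ i` annihilates `gr M` if and only if `a ∂ ^ i` maps `U_p` to `U_{p + i - 1}`
for all `p`. -/
def grAnnihilator (U : ModuleFiltration (orderFiltration K) M) : Ideal K⟦X⟧[X] :=
  Ideal.span {s | ∃ (i : ℕ) (a : K⟦X⟧), s = Polynomial.monomial i a ∧
    ∀ (p : ℤ), ∀ m ∈ U.piece p, a • (del K ^ i • m) ∈ U.piece (p + i - 1)}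

end ModuleFiltration

/-! ## Holonomic modules, localization, regularity and rank -/

/-- A left `D̂₁`-module `M` is holonomic if it has a good filtration with respect to the order
filtration (equivalently, `M` is finitely generated) and its characteristic variety, the zero set
of the annihilator of `gr M` in `gr^F D̂₁ = K[[x]][ξ]`, has dimension at most one. -/
def IsHolonomic (K : Type u) [Field K] (M : Type v) [AddCommGroup M] [Module (WeylHat K) M] : Prop :=
  ∃ U : ModuleFiltration (orderFiltration K) M, U.IsGood ∧
    ringKrullDim (K⟦X⟧[X] ⧸ U.grAnnihilator) ≤ 1

/-- The localization `M[x⁻¹] = K((x)) ⊗_{K[[x]]} M` of a left `D̂₁`-module. -/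
abbrev Loc (K : Type u) [Field K] (M : Type v) [AddCommGroup M] [Module (WeylHat K) M] : Type _ := K⸨X⸩ ⊗[K⟦X⟧] M

/-- The biadditive map `(f, m) ↦ f' ⊗ m + f ⊗ ∂ m`. -/
def locDelAux (K : Type u) [Field K] (M : Type v) [AddCommGroup M] [Module (WeylHat K) M] :
    K⸨X⸩ →+ M →+ Loc K M :=
  AddMonoidHom.mk'
    (fun f => AddMonoidHom.mk' (fun m => ddx f ⊗ₜ[K⟦X⟧] m + f ⊗ₜ[K⟦X⟧] (del K • m)) (by
      intro m n
      rw [smul_add, TensorProduct.tmul_add, TensorProduct.tmul_add]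
      abel))
    (by
      intro f g
      ext m
      simp only [map_add, TensorProduct.add_tmul, AddMonoidHom.mk'_apply, AddMonoidHom.add_apply]
      abel)

theorem locDelAux_smul (K : Type u) [Field K] (M : Type v) [AddCommGroup M] [Module (WeylHat K) M]
    (r : K⟦X⟧) (f : K⸨X⸩) (m : M) : locDelAux K M (r • f) m = locDelAux K M f (r • m) := by
  have h : ∀ (s : K⟦X⟧) (g : K⸨X⸩), s • g = (s : K⸨X⸩) * g := by
    intro s g
    rw [Algebra.smul_def]
    rfl
  change ddx (r • f) ⊗ₜ[K⟦X⟧] m + (r • f) ⊗ₜ[K⟦X⟧] (del K • m) =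
    ddx f ⊗ₜ[K⟦X⟧] (r • m) + f ⊗ₜ[K⟦X⟧] (del K • r • m)
  have h1 : ddx (r • f) = PowerSeries.derivative K r • f + r • ddx f := by
    rw [h, h, h, ddx_mul, ddx_coe]
  rw [h1, del_smul_smul, TensorProduct.add_tmul, TensorProduct.tmul_add,
    TensorProduct.smul_tmul (PowerSeries.derivative K r) f m,
    TensorProduct.smul_tmul r (ddx f) m, TensorProduct.smul_tmul r f (del K • m)]
  abel

/-- The action of `∂` on `M[x⁻¹]`: it maps `f ⊗ m` to `f' ⊗ m + f ⊗ ∂ m`. -/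
def locDel (K : Type u) [Field K] (M : Type v) [AddCommGroup M] [Module (WeylHat K) M] :
    Loc K M →+ Loc K M :=
  TensorProduct.liftAddHom (locDelAux K M) (locDelAux_smul K M)

@[simp] theorem locDel_tmul (K : Type u) [Field K] (M : Type v) [AddCommGroup M] [Module (WeylHat K) M] (f : K⸨X⸩) (m : M) :
    locDel K M (f ⊗ₜ[K⟦X⟧] m) = ddx f ⊗ₜ[K⟦X⟧] m + f ⊗ₜ[K⟦X⟧] (del K • m) := rfl

/-- `M` is regular (at `0`) if the formal meromorphic connection `M[x⁻¹]` is regular: it has a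
lattice, that is, a finitely generated `K[[x]]`-submodule that spans it over `K((x))`, which is stable
under `x ∂`. -/
def IsRegular (K : Type u) [Field K] (M : Type v) [AddCommGroup M] [Module (WeylHat K) M] : Prop :=
  ∃ L : Submodule K⟦X⟧ (Loc K M), L.FG ∧ Submodule.span K⸨X⸩ (L : Set (Loc K M)) = ⊤ ∧
    ∀ v ∈ L, (PowerSeries.X : K⟦X⟧) • locDel K M v ∈ L

/-- The rank `dim_{K((x))} (K((x)) ⊗_{K[[x]]} M)` of a left `D̂₁`-module `M`. -/
def rank (K : Type u) [Field K] (M : Type v) [AddCommGroup M] [Module (WeylHat K) M] : Cardinal :=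
  Module.rank K⸨X⸩ (Loc K M)

end FormalWeyl

end

/-!
For `k ≪ 0` the pieces of a good `V`-filtration satisfy `U_{k-n} = x ^ n U_k`, because
`V_{j-n} = x ^ n V_j` for `j ≤ 0` (`exists_eq_X_pow_mul_of_mem_V`). If such a piece `U_k` happens to
be a free `K[[x]]`-module with basis `u₁, …, u_r`, both ranks equal `r`:

* every element of `M` is moved into `U_k` by a power of `x`, so the `uᵢ` form a basis of
  `K((x)) ⊗ M`;
* the part of `gr M` in degrees `≤ k` is `⨁ₙ x ^ n U_k / x ^ (n+1) U_k`, which is free over `K[x]`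
  on the classes of the `uᵢ` (`linearIndependent_toGr`), and a power of `x` moves any element of
  `gr M` into it (`exists_X_pow_smul_mem_span_toGr`).

As `K[[x]]` is a principal ideal domain, it suffices to find a finitely generated torsion free piece
(`IsGood.exists_fg_torsionFree`). This is where regularity enters. Every `K[[x]]`-submodule stable
under `x ∂` is stable under `V_0` (`IsEulerStable.smul_mem_of_mem_V`). Let `L` be a lattice in
`M[x⁻¹]` stable under `x ∂`, and let `A ⊆ M` be generated by lifts of generators of the image in `L`
of its preimage in `M`. Then `x ∂` preserves `A` up to `x`-torsion; finitely many relations are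
involved, so it preserves `A + T` with `T` the elements killed by a fixed `x ^ n`. Up to a power of
`x`, this module contains the generators of `U`, hence `U_k` for `k ≪ 0`. Multiplication by `x ^ n`
kills `T`, so that `U_{k-n} = x ^ n U_k` lies in the finitely generated module `A`. As `K[[x]]` is
noetherian, the torsion of a finitely generated piece is killed by some `x ^ N`, and
`x ^ N U_k = U_{k-N}` is torsion free.

Characteristic zero is needed to read off the coefficients of a differential operator from its
action on the powers of `x` (`coeff_mem_xPow_of_mem_V`).
-/

open scoped PowerSeries LaurentSeries Polynomial TensorProduct

noncomputable section

universe u v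

namespace FormalWeyl

open WeylHat

variable {K : Type u} [Field K]

/-! ### Differential operators and the `V`-filtration -/

theorem op_sum {ι : Type*} (s : Finset ι) (P : ι → WeylHat K) (f : K⸨X⸩) :
    op (∑ i ∈ s, P i) f = ∑ i ∈ s, op (P i) f := by
  rw [map_sum, LinearMap.sum_apply]

/-- Every `P ∈ D̂₁` is a finite sum `∑ aᵢ ∂ ^ i`. -/
theorem WeylHat.exists_eq_sum (P : WeylHat K) :
    ∃ (n : ℕ) (a : ℕ → K⟦X⟧), P = ∑ i ∈ Finset.range n, coeffHom (a i) * del K ^ i := by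
  let S : Submodule K⟦X⟧ (WeylHat K) := Submodule.span K⟦X⟧ (Set.range fun i : ℕ => del K ^ i)
  -- `S` is a left ideal, since it is stable under the generators of `D̂₁`; it contains `1`
  have hdel : ∀ Q ∈ S, del K * Q ∈ S := by
    intro Q hQ
    induction hQ using Submodule.span_induction with
    | mem Q hQ =>
      obtain ⟨i, rfl⟩ := hQ
      exact Submodule.subset_span ⟨i + 1, pow_succ' _ _⟩
    | zero => rw [mul_zero]; exact S.zero_mem
    | add Q R _ _ hQ hR => rw [mul_add]; exact S.add_mem hQ hR
    | smul a Q hmem hQ =>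
      have h := del_smul_smul a Q
      rw [smul_eq_mul, smul_eq_mul] at h
      rw [h]
      exact S.add_mem (S.smul_mem _ hQ) (S.smul_mem _ hmem)
  have hmul : ∀ T ∈ weylSubalgebra K, ∀ Q ∈ S, ∃ R ∈ S, op R = T * op Q := by
    intro T hT
    induction hT using Algebra.adjoin_induction with
    | mem T hT =>
      intro Q hQ
      rcases hT with ⟨f, rfl⟩ | rfl
      · exact ⟨f • Q, S.smul_mem f hQ, rfl⟩
      · exact ⟨del K * Q, hdel Q hQ, rfl⟩
    | algebraMap c =>
      intro Q hQ
      refine ⟨PowerSeries.C c • Q, S.smul_mem _ hQ, LinearMap.ext fun h => ?_⟩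
      change ((PowerSeries.C c : K⟦X⟧) : K⸨X⸩) * op Q h = c • op Q h
      rw [HahnSeries.ofPowerSeries_C, HahnSeries.C_mul_eq_smul]
    | add T T' _ _ h h' =>
      intro Q hQ
      obtain ⟨R, hR, hRT⟩ := h Q hQ
      obtain ⟨R', hR', hRT'⟩ := h' Q hQ
      exact ⟨R + R', S.add_mem hR hR', by rw [map_add, hRT, hRT', add_mul]⟩
    | mul T T' _ _ h h' =>
      intro Q hQ
      obtain ⟨R', hR', hRT'⟩ := h' Q hQ
      obtain ⟨R, hR, hRT⟩ := h R' hR'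
      exact ⟨R, hR, by rw [hRT, hRT', mul_assoc]⟩
  have hP : P ∈ S := by
    obtain ⟨R, hR, hRP⟩ := hmul (op P) P.2 1 (Submodule.subset_span ⟨0, pow_zero _⟩)
    rw [map_one, mul_one] at hRP
    exact op_injective hRP ▸ hR
  obtain ⟨c, rfl⟩ := Finsupp.mem_span_range_iff_exists_finsupp.1 hP
  refine ⟨c.support.sup id + 1, c, ?_⟩
  refine Finset.sum_subset (fun i hi => ?_) (fun i _ hi => ?_)
  · rw [Finset.mem_range, Nat.lt_succ_iff]
    exact Finset.le_sup (f := id) hi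
  · simp [Finsupp.notMem_support_iff.1 hi]

theorem ddx_one : ddx (1 : K⸨X⸩) = 0 := by
  have := ddx_coe (1 : K⟦X⟧)
  simpa using this

theorem ddx_mem_xPow {p : ℤ} {f : K⸨X⸩} (hf : f ∈ xPow p) : ddx f ∈ xPow (p - 1) := by
  intro n hn
  rw [coeff_ddx, hf _ (by omega), mul_zero]

theorem op_del_pow_mem_xPow (i : ℕ) {p : ℤ} {f : K⸨X⸩} (hf : f ∈ xPow p) :
    op (del K ^ i) f ∈ xPow (p - i) := by
  induction i generalizing p f with
  | zero => simpa using hf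
  | succ i ih =>
    rw [pow_succ, map_mul, Module.End.mul_apply, op_del]
    convert ih (ddx_mem_xPow hf) using 2
    push_cast
    ring

theorem op_del_pow_X_pow_self (i : ℕ) :
    op (del K ^ i) ((PowerSeries.X ^ i : K⟦X⟧) : K⸨X⸩) = (i.factorial : K) • (1 : K⸨X⸩) := by
  induction i with
  | zero => simp
  | succ i ih =>
    have h : PowerSeries.derivative K (PowerSeries.X ^ (i + 1) : K⟦X⟧) =
        PowerSeries.C ((i : K) + 1) * PowerSeries.X ^ i := by
      rw [Derivation.leibniz_pow]
      simp
    rw [pow_succ, map_mul, Module.End.mul_apply, op_del, ddx_coe, h, map_mul,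
      HahnSeries.ofPowerSeries_C, HahnSeries.C_mul_eq_smul, map_smul, ih, smul_smul,
      Nat.factorial_succ]
    push_cast
    rfl

theorem op_del_pow_X_pow_of_lt {i l : ℕ} (h : i < l) :
    op (del K ^ l) ((PowerSeries.X ^ i : K⟦X⟧) : K⸨X⸩) = 0 := by
  obtain ⟨d, rfl⟩ := Nat.exists_eq_add_of_lt h
  rw [show i + d + 1 = d + 1 + i by ring, pow_add, map_mul, Module.End.mul_apply,
    op_del_pow_X_pow_self, map_smul, pow_succ, map_mul, Module.End.mul_apply, op_del, ddx_one,
    map_zero, smul_zero]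

theorem coe_X_pow_mem_xPow (n : ℕ) : ((PowerSeries.X ^ n : K⟦X⟧) : K⸨X⸩) ∈ xPow (n : ℤ) := by
  induction n with
  | zero => exact coe_mem_xPow _
  | succ n ih =>
    rw [pow_succ, map_mul, Nat.cast_succ]
    exact mul_mem_xPow ih coe_X_mem_xPow

theorem X_pow_dvd_of_mem_xPow {n : ℕ} {f : K⟦X⟧} (hf : (f : K⸨X⸩) ∈ xPow (n : ℤ)) :
    PowerSeries.X ^ n ∣ f := by
  rw [PowerSeries.X_pow_dvd_iff]
  intro m hm
  rw [← LaurentSeries.coeff_coe_powerSeries]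
  exact hf m (by exact_mod_cast hm)

theorem X_pow_mem_V (n : ℕ) : coeffHom (PowerSeries.X ^ n : K⟦X⟧) ∈ V K (-n) := by
  intro p f hf
  rw [op_coeffHom, sub_neg_eq_add, add_comm]
  exact mul_mem_xPow (coe_X_pow_mem_xPow n) hf

theorem V_mono : Monotone (V K) := by
  intro i j hij P hP p f hf n hn
  exact hP p f hf n (by omega)

theorem mem_V_of_X_pow_mul_mem {n : ℕ} {j : ℤ} {Q : WeylHat K}
    (h : coeffHom (PowerSeries.X ^ n) * Q ∈ V K (j - n)) : Q ∈ V K j := by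
  intro p f hf m hm
  have := h p f hf (m + n) (by omega)
  rw [map_mul, Module.End.mul_apply, op_coeffHom, HahnSeries.ofPowerSeries_X_pow] at this
  rwa [HahnSeries.coeff_single_mul_add, one_mul] at this

section CharZero

variable [CharZero K]

/-- If `∑ aᵢ ∂ ^ i ∈ V_j`, then `aᵢ ∈ K[[x]] x ^ (i - j)`: the order of vanishing of `aᵢ` can be
read off by applying the operator to `x ^ i`, by induction on `i`. -/
theorem coeff_mem_xPow_of_mem_V {n : ℕ} {a : ℕ → K⟦X⟧} {j : ℤ}
    (hP : ∑ i ∈ Finset.range n, coeffHom (a i) * del K ^ i ∈ V K j) {i : ℕ} (hi : i < n) :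
    (a i : K⸨X⸩) ∈ xPow ((i : ℤ) - j) := by
  induction i using Nat.strong_induction_on with
  | _ i ih =>
  have h := hP i _ (coe_X_pow_mem_xPow i)
  rw [op_sum, ← Finset.add_sum_erase _ _ (Finset.mem_range.2 hi)] at h
  have hrest : ∑ l ∈ (Finset.range n).erase i,
      op (coeffHom (a l) * del K ^ l) ((PowerSeries.X ^ i : K⟦X⟧) : K⸨X⸩) ∈ xPow ((i : ℤ) - j) := by
    refine Submodule.sum_mem _ fun l hl => ?_
    rw [Finset.mem_erase, Finset.mem_range] at hl
    rw [map_mul, Module.End.mul_apply, op_coeffHom]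
    -- the terms with `l < i` are controlled by induction, those with `l > i` kill `x ^ i`
    rcases lt_or_gt_of_ne hl.1 with hli | hli
    · have := mul_mem_xPow (ih l hli hl.2) (op_del_pow_mem_xPow l (coe_X_pow_mem_xPow i))
      convert this using 2
      ring
    · rw [op_del_pow_X_pow_of_lt hli, mul_zero]
      exact Submodule.zero_mem _
  have hmain := (Submodule.add_mem_iff_left _ hrest).1 h
  rw [map_mul, Module.End.mul_apply, op_coeffHom, op_del_pow_X_pow_self, mul_comm,
    ← HahnSeries.C_mul_eq_smul, mul_one, HahnSeries.C_mul_eq_smul] at hmain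
  exact (Submodule.smul_mem_iff _ (Nat.cast_ne_zero.2 i.factorial_ne_zero)).1 hmain

/-- Every element of `V_0` is a finite sum `∑ bᵢ x ^ i ∂ ^ i`. -/
theorem exists_eq_sum_X_pow_of_mem_V_zero {Q : WeylHat K} (hQ : Q ∈ V K 0) :
    ∃ (n : ℕ) (b : ℕ → K⟦X⟧),
      Q = ∑ i ∈ Finset.range n, coeffHom (b i * PowerSeries.X ^ i) * del K ^ i := by
  obtain ⟨n, a, rfl⟩ := Q.exists_eq_sum
  have h : ∀ i, ∃ b, i < n → a i = b * PowerSeries.X ^ i := by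
    intro i
    by_cases hi : i < n
    · have := coeff_mem_xPow_of_mem_V hQ hi
      rw [sub_zero] at this
      obtain ⟨b, hb⟩ := X_pow_dvd_of_mem_xPow this
      exact ⟨b, fun _ => hb.trans (mul_comm _ _)⟩
    · exact ⟨0, fun h => absurd h hi⟩
  choose b hb using h
  exact ⟨n, b, Finset.sum_congr rfl fun i hi => by rw [hb i (Finset.mem_range.1 hi)]⟩

/-- `V_{j-n} ⊆ x ^ n V_j` for `j ≤ 0`. -/
theorem exists_eq_X_pow_mul_of_mem_V {j : ℤ} (hj : j ≤ 0) {n : ℕ} {P : WeylHat K}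
    (hP : P ∈ V K (j - n)) : ∃ Q ∈ V K j, P = coeffHom (PowerSeries.X ^ n) * Q := by
  obtain ⟨N, a, rfl⟩ := P.exists_eq_sum
  have h : ∀ i, ∃ b, i < N → a i = PowerSeries.X ^ n * b := by
    intro i
    by_cases hi : i < N
    · have := coeff_mem_xPow_of_mem_V hP hi
      have hdvd : PowerSeries.X ^ n ∣ a i :=
        X_pow_dvd_of_mem_xPow fun m hm => this m (by omega)
      exact hdvd.imp fun b hb _ => hb
    · exact ⟨0, fun h => absurd h hi⟩
  choose b hb using h
  have heq : ∑ i ∈ Finset.range N, coeffHom (a i) * del K ^ i =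
      coeffHom (PowerSeries.X ^ n) * ∑ i ∈ Finset.range N, coeffHom (b i) * del K ^ i := by
    rw [Finset.mul_sum]
    refine Finset.sum_congr rfl fun i hi => ?_
    rw [hb i (Finset.mem_range.1 hi), map_mul, mul_assoc]
  rw [heq] at hP
  exact ⟨_, mem_V_of_X_pow_mul_mem hP, heq⟩

end CharZero

/-! ### Submodules stable under the Euler operator -/

theorem exists_nat_forall_mem_of_monotone {α : Type*} {p : ℕ → α → Prop}
    (hp : ∀ i j m, i ≤ j → p i m → p j m) (s : Finset α)
    (h : ∀ m ∈ s, ∃ n, p n m) : ∃ n, ∀ m ∈ s, p n m := by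
  choose! f hf using h
  exact ⟨s.sup f, fun m hm => hp _ _ m (Finset.le_sup hm) (hf m hm)⟩

variable {M : Type v} [AddCommGroup M] [Module (WeylHat K) M]

/-- A `K[[x]]`-submodule `N` of a `D̂₁`-module is stable under the Euler operator `x ∂`. -/
def IsEulerStable (N : Submodule K⟦X⟧ M) : Prop :=
  ∀ m ∈ N, (PowerSeries.X : K⟦X⟧) • del K • m ∈ N

/-- The commutation rule `(x ∂) x ^ n = x ^ n (x ∂) + n x ^ n`. -/
theorem euler_smul_X_pow (n : ℕ) (m : M) :
    (PowerSeries.X : K⟦X⟧) • del K • (PowerSeries.X : K⟦X⟧) ^ n • m =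
      (PowerSeries.X : K⟦X⟧) ^ n • ((PowerSeries.X : K⟦X⟧) • del K • m) +
        (n : K⟦X⟧) • (PowerSeries.X : K⟦X⟧) ^ n • m := by
  have h : (PowerSeries.X : K⟦X⟧) * PowerSeries.derivative K ((PowerSeries.X : K⟦X⟧) ^ n) =
      (n : K⟦X⟧) * (PowerSeries.X : K⟦X⟧) ^ n := by
    cases n with
    | zero => simp
    | succ n =>
      rw [Derivation.leibniz_pow]
      simp
      ring
  rw [del_smul_smul, smul_add, smul_smul _ (PowerSeries.derivative K _), h, mul_smul,
    smul_comm (PowerSeries.X : K⟦X⟧)]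

theorem IsEulerStable.comap {N : Submodule K⟦X⟧ M} (hN : IsEulerStable N) (n : ℕ) :
    IsEulerStable (N.comap (LinearMap.lsmul K⟦X⟧ M (PowerSeries.X ^ n))) := by
  intro m hm
  rw [Submodule.mem_comap, LinearMap.lsmul_apply] at hm ⊢
  have h := hN _ hm
  rw [euler_smul_X_pow] at h
  exact (Submodule.add_mem_iff_left _ (N.smul_mem _ hm)).1 h

/-- Stability under all `x ^ i ∂ ^ i`, by `x ^ (i+1) ∂ ^ (i+1) = (x ∂ - i) x ^ i ∂ ^ i`. -/
theorem IsEulerStable.X_pow_smul_del_pow_smul_mem {N : Submodule K⟦X⟧ M} (hN : IsEulerStable N)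
    (i : ℕ) {m : M} (hm : m ∈ N) : (PowerSeries.X : K⟦X⟧) ^ i • del K ^ i • m ∈ N := by
  induction i with
  | zero => simpa using hm
  | succ i ih =>
    have h := hN _ ih
    rw [euler_smul_X_pow, Submodule.add_mem_iff_left _ (N.smul_mem _ ih)] at h
    rwa [pow_succ, pow_succ', mul_smul, mul_smul]

theorem IsEulerStable.smul_mem_of_mem_V [CharZero K] {N : Submodule K⟦X⟧ M}
    (hN : IsEulerStable N) {Q : WeylHat K} (hQ : Q ∈ V K 0) {m : M} (hm : m ∈ N) : Q • m ∈ N := by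
  obtain ⟨n, b, rfl⟩ := exists_eq_sum_X_pow_of_mem_V_zero hQ
  rw [Finset.sum_smul]
  refine N.sum_mem fun i _ => ?_
  rw [mul_smul, ← powerSeries_smul_def, mul_smul]
  exact N.smul_mem _ (hN.X_pow_smul_del_pow_smul_mem i hm)

variable (K M) in
/-- The elements of `M` killed by `x ^ n`. -/
def xTorsion (n : ℕ) : Submodule K⟦X⟧ M :=
  (⊥ : Submodule K⟦X⟧ M).comap (LinearMap.lsmul K⟦X⟧ M (PowerSeries.X ^ n))

theorem mem_xTorsion {n : ℕ} {m : M} :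
    m ∈ xTorsion K M n ↔ (PowerSeries.X : K⟦X⟧) ^ n • m = 0 := Iff.rfl

theorem isEulerStable_xTorsion (n : ℕ) : IsEulerStable (xTorsion K M n) := by
  refine IsEulerStable.comap (fun m hm => ?_) n
  rw [(Submodule.mem_bot _).1 hm, smul_zero, smul_zero]
  exact Submodule.zero_mem _

theorem xTorsion_mono : Monotone (xTorsion K M) := by
  intro i j hij m hm
  rw [mem_xTorsion] at hm ⊢
  rw [← Nat.sub_add_cancel hij, pow_add, mul_smul, hm, smul_zero]

variable (K M) in
/-- The localization map `M → M[x⁻¹]`. -/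
def toLoc : M →ₗ[K⟦X⟧] Loc K M := TensorProduct.mk K⟦X⟧ K⸨X⸩ M 1

instance : IsLocalizedModule (Submonoid.powers (PowerSeries.X : K⟦X⟧)) (toLoc K M) :=
  (isLocalizedModule_iff_isBaseChange _ K⸨X⸩ _).mpr (TensorProduct.isBaseChange K⟦X⟧ M K⸨X⸩)

theorem exists_mem_xTorsion_of_toLoc_eq_zero {m : M} (hm : toLoc K M m = 0) :
    ∃ n, m ∈ xTorsion K M n := by
  obtain ⟨⟨_, n, rfl⟩, hn⟩ :=
    (IsLocalizedModule.eq_zero_iff (Submonoid.powers (PowerSeries.X : K⟦X⟧)) (toLoc K M)).1 hm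
  exact ⟨n, hn⟩

theorem toLoc_euler (m : M) : toLoc K M ((PowerSeries.X : K⟦X⟧) • del K • m) =
    (PowerSeries.X : K⟦X⟧) • locDel K M (toLoc K M m) := by
  rw [map_smul]
  congr 1
  change _ = locDel K M (1 ⊗ₜ[K⟦X⟧] m)
  rw [locDel_tmul, ddx_one, TensorProduct.zero_tmul, zero_add]
  rfl

theorem exists_X_pow_smul_mem {L : Submodule K⟦X⟧ (Loc K M)}
    (hL : Submodule.span K⸨X⸩ (L : Set (Loc K M)) = ⊤) (v : Loc K M) :
    ∃ n : ℕ, (PowerSeries.X : K⟦X⟧) ^ n • v ∈ L := by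
  have hv : v ∈ Submodule.span K⸨X⸩ (L : Set (Loc K M)) := hL ▸ Submodule.mem_top
  induction hv using Submodule.span_induction with
  | mem v hv => exact ⟨0, by simpa using hv⟩
  | zero => exact ⟨0, by simp⟩
  | add v w _ _ hv hw =>
    obtain ⟨n, hn⟩ := hv
    obtain ⟨k, hk⟩ := hw
    refine ⟨n + k, ?_⟩
    rw [smul_add, pow_add, mul_smul, mul_smul, smul_comm (PowerSeries.X ^ n) _ v]
    exact L.add_mem (L.smul_mem _ hn) (L.smul_mem _ hk)
  | smul f v _ hv =>
    obtain ⟨n, hn⟩ := hv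
    obtain ⟨⟨a, ⟨_, k, rfl⟩⟩, hk⟩ :=
      IsLocalization.surj (Submonoid.powers (PowerSeries.X : K⟦X⟧)) f
    refine ⟨k + n, ?_⟩
    have hk' : (PowerSeries.X : K⟦X⟧) ^ k • f = algebraMap K⟦X⟧ K⸨X⸩ a := by
      rw [← hk, Algebra.smul_def, mul_comm]
    have : (PowerSeries.X : K⟦X⟧) ^ (k + n) • f • v = a • (PowerSeries.X : K⟦X⟧) ^ n • v := by
      rw [pow_add, mul_comm, mul_smul, ← smul_assoc (PowerSeries.X ^ k) f v, hk', algebraMap_smul,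
        smul_comm]
    rw [this]
    exact L.smul_mem _ hn

/-- The torsion of a finitely generated `K[[x]]`-submodule is killed by a single power of `x`. -/
theorem exists_X_pow_smul_eq_zero_of_fg {N : Submodule K⟦X⟧ M} (hN : N.FG) :
    ∃ n, ∀ m ∈ N, toLoc K M m = 0 → m ∈ xTorsion K M n := by
  obtain ⟨t, ht⟩ : (N ⊓ LinearMap.ker (toLoc K M)).FG := hN.of_le inf_le_left
  have htN : ∀ m ∈ t, m ∈ N ⊓ LinearMap.ker (toLoc K M) :=
    fun m hm => ht ▸ Submodule.subset_span hm
  obtain ⟨n, hn⟩ := exists_nat_forall_mem_of_monotone (p := fun n m => m ∈ xTorsion K M n)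
    (fun i j m hij hm => xTorsion_mono hij hm) t
    fun m hm => exists_mem_xTorsion_of_toLoc_eq_zero (htN m hm).2
  refine ⟨n, fun m hm h => ?_⟩
  have hle : N ⊓ LinearMap.ker (toLoc K M) ≤ xTorsion K M n := ht ▸ Submodule.span_le.2 hn
  exact hle ⟨hm, h⟩

theorem toLoc_eq_zero_of_smul_eq_zero {a : K⟦X⟧} (ha : a ≠ 0) {m : M} (h : a • m = 0) :
    toLoc K M m = 0 := by
  have h' : algebraMap K⟦X⟧ K⸨X⸩ a • toLoc K M m = 0 := by
    rw [algebraMap_smul, ← map_smul, h, map_zero]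
  have ha' : algebraMap K⟦X⟧ K⸨X⸩ a ≠ 0 := by
    rwa [map_ne_zero_iff _ (IsFractionRing.injective K⟦X⟧ K⸨X⸩)]
  rw [← inv_smul_smul₀ ha' (toLoc K M m), h', smul_zero]

/-- If `M` is regular, any finitely many elements lie, after multiplication by a power of `x`, in an
Euler-stable submodule which is finitely generated over `K[[x]]` up to `x`-torsion of bounded
exponent. -/
theorem IsRegular.exists_fg_isEulerStable_sup (reg : IsRegular K M) (s : Finset M) :
    ∃ (A : Submodule K⟦X⟧ M) (n d : ℕ), A.FG ∧ IsEulerStable (A ⊔ xTorsion K M n) ∧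
      ∀ m ∈ s, (PowerSeries.X : K⟦X⟧) ^ d • m ∈ A ⊔ xTorsion K M n := by
  obtain ⟨L, hLfg, hLspan, hL⟩ := reg
  let N : Submodule K⟦X⟧ M := L.comap (toLoc K M)
  have hN : IsEulerStable N := fun m hm => by
    rw [Submodule.mem_comap, toLoc_euler]
    exact hL _ hm
  have hNfg : (N.map (toLoc K M)).FG := by
    exact Submodule.FG.of_le hLfg (Submodule.map_comap_le _ _)
  -- `A` is generated by lifts of generators of the image of `N`
  obtain ⟨A, hAN, hAfg, hA⟩ : ∃ A ≤ N, A.FG ∧ N.map (toLoc K M) ≤ A.map (toLoc K M) := by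
    classical
    obtain ⟨t, ht⟩ := hNfg
    have htN : (t : Set (Loc K M)) ⊆ toLoc K M '' N := by
      rw [← Submodule.map_coe, ← ht]
      exact Submodule.subset_span
    obtain ⟨t', ht'N, rfl⟩ := Finset.subset_set_image_iff.1 htN
    refine ⟨Submodule.span K⟦X⟧ t', Submodule.span_le.2 ht'N, ⟨t', rfl⟩, ?_⟩
    rw [Submodule.map_span, ← Finset.coe_image, ht]
  -- elements of `N` with the same image in the localization differ by `x`-torsion
  have hcover : ∀ m ∈ N, ∃ n, m ∈ A ⊔ xTorsion K M n := by
    intro m hm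
    obtain ⟨a, ha, ham⟩ := hA (Submodule.mem_map_of_mem hm)
    obtain ⟨n, hn⟩ := exists_mem_xTorsion_of_toLoc_eq_zero (K := K) (m := m - a) (by
      rw [map_sub (toLoc K M), ham, sub_self])
    exact ⟨n, Submodule.mem_sup.2 ⟨a, ha, m - a, hn, add_sub_cancel _ _⟩⟩
  have hmono : ∀ i j (m : M), i ≤ j → m ∈ A ⊔ xTorsion K M i → m ∈ A ⊔ xTorsion K M j :=
    fun i j m hij hm => sup_le_sup_left (xTorsion_mono hij) A hm
  obtain ⟨t, rfl⟩ := hAfg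
  obtain ⟨d, hd⟩ := exists_nat_forall_mem_of_monotone
    (p := fun n m => (PowerSeries.X : K⟦X⟧) ^ n • m ∈ N)
    (fun i j m hij hm => by
      rw [← Nat.sub_add_cancel hij, pow_add, mul_smul]
      exact N.smul_mem _ hm) s fun m _ => by
        obtain ⟨n, hn⟩ := exists_X_pow_smul_mem hLspan (toLoc K M m)
        exact ⟨n, by rwa [Submodule.mem_comap, map_smul]⟩
  classical
  -- one exponent `n` for the finitely many elements `x ∂ e`, `e ∈ t`, and `x ^ d m`, `m ∈ s`
  obtain ⟨n, hn⟩ := exists_nat_forall_mem_of_monotone hmono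
    (t.image (fun m => (PowerSeries.X : K⟦X⟧) • del K • m) ∪
      s.image (fun m => (PowerSeries.X : K⟦X⟧) ^ d • m)) (by
    intro m hm
    apply hcover
    rcases Finset.mem_union.1 hm with hm | hm
    · obtain ⟨e, he, rfl⟩ := Finset.mem_image.1 hm
      exact hN e (hAN (Submodule.subset_span he))
    · obtain ⟨e, he, rfl⟩ := Finset.mem_image.1 hm
      exact hd e he)
  refine ⟨Submodule.span K⟦X⟧ (t : Set M), n, d, ⟨t, rfl⟩, ?_, fun m hm =>
    hn _ (Finset.mem_union_right _ (Finset.mem_image_of_mem _ hm))⟩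
  have hgen : ∀ a ∈ Submodule.span K⟦X⟧ (t : Set M), (PowerSeries.X : K⟦X⟧) • del K • a ∈
      Submodule.span K⟦X⟧ (t : Set M) ⊔ xTorsion K M n := by
    intro a ha
    induction ha using Submodule.span_induction with
    | mem a ha => exact hn _ (Finset.mem_union_left _ (Finset.mem_image_of_mem _ ha))
    | zero => simp
    | add a b _ _ ha hb =>
      rw [smul_add, smul_add]
      exact Submodule.add_mem _ ha hb
    | smul f a ha h =>
      rw [del_smul_smul, smul_add, smul_comm _ f]
      exact Submodule.add_mem _ (Submodule.smul_mem _ _ h)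
        (Submodule.smul_mem _ _ (Submodule.smul_mem _ _ (Submodule.mem_sup_left ha)))
  intro m hm
  obtain ⟨a, ha, b, hb, rfl⟩ := Submodule.mem_sup.1 hm
  rw [smul_add, smul_add]
  exact Submodule.add_mem _ (hgen a ha) (Submodule.mem_sup_right (isEulerStable_xTorsion n b hb))

namespace ModuleFiltration

theorem X_pow_smul_mem (U : ModuleFiltration (V K) M) {k : ℤ} {m : M} (hm : m ∈ U.piece k) (n : ℕ) :
    (PowerSeries.X : K⟦X⟧) ^ n • m ∈ U.piece (k - n) := by
  have h := U.smul_mem (-n) k _ m (X_pow_mem_V n) hm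
  rwa [neg_add_eq_sub] at h

variable [CharZero K] {U : ModuleFiltration (V K) M}

/-- For `k ≪ 0` and all `n`, `U_{k-n} ⊆ x ^ n U_k`. -/
theorem IsGood.exists_eq_X_pow_smul (hU : U.IsGood) :
    ∃ k₁ : ℤ, ∀ k ≤ k₁, ∀ (n : ℕ), ∀ m ∈ U.piece (k - n),
      ∃ m' ∈ U.piece k, m = (PowerSeries.X : K⟦X⟧) ^ n • m' := by
  obtain ⟨s, g, e, hp⟩ := hU
  obtain ⟨k₁, hk₁⟩ := (Set.finite_range e).bddBelow
  refine ⟨k₁, fun k hk n m hm => ?_⟩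
  suffices h : U.piece (k - n) ≤
      (U.piece k).map (LinearMap.lsmul K⟦X⟧ M (PowerSeries.X ^ n)) by
    obtain ⟨m', hm', h⟩ := h hm
    exact ⟨m', hm', h.symm⟩
  rw [hp (k - n)]
  refine iSup_le fun i => ?_
  rintro _ ⟨P, hP, rfl⟩
  have hP' : P ∈ V K (k - e i - n) := by
    rwa [sub_right_comm]
  obtain ⟨Q, hQ, rfl⟩ := exists_eq_X_pow_mul_of_mem_V
    (by have := hk₁ ⟨i, rfl⟩; omega) hP'
  refine ⟨Q • g i, ?_, ?_⟩
  · rw [SetLike.mem_coe, hp k]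
    exact Submodule.mem_iSup_of_mem i ⟨Q, hQ, rfl⟩
  · exact (mul_smul (coeffHom (PowerSeries.X ^ n)) Q (g i)).symm

/-- For a regular module, the pieces `U_k` with `k ≪ 0` are finitely generated over `K[[x]]`. -/
theorem IsGood.exists_fg (hU : U.IsGood) (reg : IsRegular K M) :
    ∃ k₁ : ℤ, ∀ k ≤ k₁, (U.piece k).FG := by
  obtain ⟨k₀, hk₀⟩ := hU.exists_eq_X_pow_smul
  obtain ⟨s, g, e, hp⟩ := hU
  obtain ⟨k₂, hk₂⟩ := (Set.finite_range e).bddBelow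
  classical
  obtain ⟨A, n, d, hA, hE, hgA⟩ := reg.exists_fg_isEulerStable_sup (Finset.univ.image g)
  have hle : U.piece (min k₀ k₂) ≤
      (A ⊔ xTorsion K M n).comap (LinearMap.lsmul K⟦X⟧ M (PowerSeries.X ^ d)) := by
    rw [hp]
    refine iSup_le fun i => ?_
    rintro _ ⟨P, hP, rfl⟩
    refine (hE.comap d).smul_mem_of_mem_V (V_mono ?_ hP)
      (hgA _ (Finset.mem_image_of_mem _ (Finset.mem_univ i)))
    have := hk₂ ⟨i, rfl⟩
    omega
  -- `x ^ d` moves the piece into `A + T`, and `x ^ n` then kills the torsion part `T`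
  refine ⟨min k₀ k₂ - (n + d : ℕ), fun k hk => ?_⟩
  refine hA.of_le fun m hm => ?_
  obtain ⟨m', hm', rfl⟩ := hk₀ (min k₀ k₂) (min_le_left _ _) (n + d) m (U.mono hk hm)
  obtain ⟨a, ha, b, hb, hab⟩ := Submodule.mem_sup.1 (hle hm')
  rw [pow_add, mul_smul]
  rw [LinearMap.lsmul_apply] at hab
  rw [← hab, smul_add, mem_xTorsion.1 hb, add_zero]
  exact A.smul_mem _ ha

/-- For a regular module, some piece `U_k` is finitely generated and torsion free over `K[[x]]` and
satisfies `U_{k-n} ⊆ x ^ n U_k` for all `n`. -/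
theorem IsGood.exists_fg_torsionFree (hU : U.IsGood) (reg : IsRegular K M) :
    ∃ k : ℤ, (U.piece k).FG ∧ Module.IsTorsionFree K⟦X⟧ (U.piece k) ∧
      ∀ (n : ℕ), ∀ m ∈ U.piece (k - n),
        ∃ m' ∈ U.piece k, m = (PowerSeries.X : K⟦X⟧) ^ n • m' := by
  obtain ⟨k₀, hk₀⟩ := hU.exists_eq_X_pow_smul
  obtain ⟨k₁, hk₁⟩ := hU.exists_fg reg
  obtain ⟨N, hN⟩ := exists_X_pow_smul_eq_zero_of_fg (hk₁ (min k₀ k₁) (min_le_right _ _))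
  refine ⟨min k₀ k₁ - N, hk₁ _ (by omega), .of_smul_eq_zero fun a m h => ?_,
    hk₀ _ (by omega)⟩
  by_cases ha : a = 0
  · exact Or.inl ha
  right
  obtain ⟨m, hm⟩ := m
  obtain ⟨m', hm', rfl⟩ := hk₀ _ (min_le_left _ _) N m hm
  have h' : (a * (PowerSeries.X : K⟦X⟧) ^ N) • m' = 0 := by
    rw [mul_smul]
    exact congrArg Subtype.val h
  have h0 := toLoc_eq_zero_of_smul_eq_zero (mul_ne_zero ha (pow_ne_zero N PowerSeries.X_ne_zero)) h'
  exact Subtype.ext (hN m' hm' h0)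

end ModuleFiltration

/-! ### The associated graded module and the ranks -/

/-- Over a domain, linearly independent elements that span a module up to torsion compute its
rank. -/
theorem rank_tensor_eq_of_linearIndependent {R : Type*} [CommRing R] [IsDomain R] (F : Type*)
    [Field F] [Algebra R F] [IsFractionRing R F] {N : Type*} [AddCommGroup N] [Module R N] {n : ℕ}
    {w : Fin n → N} (hw : LinearIndependent R w)
    (htors : ∀ m, ∃ a : R, a ≠ 0 ∧ a • m ∈ Submodule.span R (Set.range w)) :
    Module.rank F (F ⊗[R] N) = n := by
  have h1 : Module.rank R N = n := by
    rw [← rank_quotient_add_rank_of_isDomain (Submodule.span R (Set.range w)),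
      rank_eq_card_basis (Module.Basis.span hw), Fintype.card_fin, rank_eq_zero_iff.2, zero_add]
    intro q
    obtain ⟨m, rfl⟩ := Submodule.Quotient.mk_surjective _ q
    obtain ⟨a, ha, h⟩ := htors m
    exact ⟨a, ha, by rwa [← Submodule.Quotient.mk_smul, Submodule.Quotient.mk_eq_zero]⟩
  have : IsLocalizedModule (nonZeroDivisors R) (TensorProduct.mk R F N 1) :=
    (isLocalizedModule_iff_isBaseChange _ F _).mpr (TensorProduct.isBaseChange R N F)
  have h2 := IsLocalizedModule.lift_rank_eq (nonZeroDivisors R) (TensorProduct.mk R F N 1) le_rfl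
  rw [h1, Cardinal.lift_natCast, Cardinal.lift_eq_nat_iff] at h2
  rw [IsLocalization.rank_eq F (nonZeroDivisors R) le_rfl, h2]

namespace ModuleFiltration

variable (U : ModuleFiltration (V K) M)

/-- Multiplication by `x ^ n` as a map `U_k → U_{k-n}`. -/
def mulXPow (k : ℤ) (n : ℕ) : U.piece k →ₗ[K⟦X⟧] U.piece (k - n) :=
  (LinearMap.lsmul K⟦X⟧ M (PowerSeries.X ^ n)).restrict fun _ hm => U.X_pow_smul_mem hm n

@[simp] theorem coe_mulXPow (k : ℤ) (n : ℕ) (m : U.piece k) :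
    (U.mulXPow k n m : M) = (PowerSeries.X : K⟦X⟧) ^ n • (m : M) := rfl

/-- The projection `U_k → gr_k M`. -/
def toGrPiece (k : ℤ) : U.piece k →ₗ[K⟦X⟧] U.GrPiece k :=
  ((U.piece (k - 1)).submoduleOf (U.piece k)).mkQ

theorem toGrPiece_eq_zero_iff {k : ℤ} {m : U.piece k} :
    U.toGrPiece k m = 0 ↔ (m : M) ∈ U.piece (k - 1) :=
  Submodule.Quotient.mk_eq_zero _

/-- The inclusion of `gr_k M` into `gr M`. -/
def grOf (k : ℤ) : U.GrPiece k →ₗ[K⟦X⟧] U.Gr := DirectSum.lof K⟦X⟧ ℤ U.GrPiece k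

theorem gr_induction {p : U.Gr → Prop} (zero : p 0)
    (of : ∀ (k : ℤ) (m : U.piece k), p (U.grOf k (U.toGrPiece k m)))
    (add : ∀ g g', p g → p g' → p (g + g')) (g : U.Gr) : p g := by
  refine DirectSum.induction_on (motive := p) g zero (fun k q => ?_) add
  obtain ⟨m, rfl⟩ := Submodule.Quotient.mk_surjective _ q
  exact of k m

/-- The map `U_k → gr M` taking an element to its class in degree `k`. -/
def toGr (k : ℤ) : U.piece k →ₗ[K⟦X⟧] U.Gr :=
  U.grOf k ∘ₗ U.toGrPiece k

theorem toGr_eq_zero {k : ℤ} {m : U.piece k} (h : (m : M) ∈ U.piece (k - 1)) :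
    U.toGr k m = 0 := by
  rw [toGr, LinearMap.comp_apply, U.toGrPiece_eq_zero_iff.2 h, map_zero]

/-- The projection of `gr M` to its component of degree `k`. -/
def grComponent (k : ℤ) : U.Gr →ₗ[K⟦X⟧] U.GrPiece k := DirectSum.component K⟦X⟧ ℤ U.GrPiece k

theorem grComponent_toGr_same {k : ℤ} (m : U.piece k) :
    U.grComponent k (U.toGr k m) = U.toGrPiece k m :=
  DirectSum.component.lof_self _ _ _

theorem grComponent_toGr_of_ne {k l : ℤ} (h : l ≠ k) (m : U.piece l) :
    U.grComponent k (U.toGr l m) = 0 := by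
  have := DirectSum.component.of (R := K⟦X⟧) (M := U.GrPiece) k l (U.toGrPiece l m)
  rw [dif_neg h] at this
  exact this

theorem C_smul_gr (c : K) (g : U.Gr) :
    (Polynomial.C c : K[X]) • g = (PowerSeries.C c : K⟦X⟧) • g := by
  change Polynomial.aeval U.grX ((Polynomial.C c).map (PowerSeries.C (R := K))) g = _
  simp

theorem X_smul_gr (g : U.Gr) : (Polynomial.X : K[X]) • g = U.grX g := by
  change Polynomial.aeval U.grX (Polynomial.X.map (PowerSeries.C (R := K))) g = _
  simp

theorem grX_toGr {k : ℤ} (m : U.piece k) : U.grX (U.toGr k m) = U.toGr (k - 1) (U.mulX k m) := by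
  exact DirectSum.toModule_lof (ι := ℤ) (M := U.GrPiece) (N := U.Gr) K⟦X⟧ k _

theorem toGr_congr {k l : ℤ} (h : k = l) {m : U.piece k} {m' : U.piece l} (hm : (m : M) = m') :
    U.toGr k m = U.toGr l m' := by
  subst h
  rw [Subtype.ext hm]

theorem X_pow_smul_toGr {k : ℤ} (n : ℕ) (m : U.piece k) :
    (Polynomial.X ^ n : K[X]) • U.toGr k m = U.toGr (k - n) (U.mulXPow k n m) := by
  induction n with
  | zero =>
    rw [pow_zero, one_smul]
    exact U.toGr_congr (by simp) (by rw [coe_mulXPow, pow_zero, one_smul])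
  | succ n ih =>
    rw [pow_succ', mul_smul, ih, X_smul_gr, grX_toGr]
    refine U.toGr_congr (by push_cast; ring) ?_
    rw [coe_mulXPow, pow_succ', mul_smul]
    rfl

/-- The component of `p • [m]` in degree `k - n` only sees the coefficient of `x ^ n` in `p`. -/
theorem grComponent_smul_toGr {k : ℤ} (p : K[X]) (m : U.piece k) (n : ℕ) :
    U.grComponent (k - n) (p • U.toGr k m) =
      U.toGrPiece (k - n) (U.mulXPow k n ((PowerSeries.C (p.coeff n) : K⟦X⟧) • m)) := by
  induction p using Polynomial.induction_on' with
  | add p q hp hq =>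
    rw [add_smul, map_add, hp, hq, Polynomial.coeff_add, map_add, add_smul, map_add, map_add]
  | monomial l c =>
    rw [← Polynomial.C_mul_X_pow_eq_monomial, mul_smul, X_pow_smul_toGr, C_smul_gr, map_smul,
      Polynomial.coeff_C_mul_X_pow]
    by_cases h : n = l
    · subst h
      rw [if_pos rfl, grComponent_toGr_same, map_smul, map_smul]
    · rw [if_neg h, grComponent_toGr_of_ne _ (by omega), smul_zero, map_zero, zero_smul, map_zero,
        map_zero]

variable {U} {k : ℤ} {n : ℕ} (b : Module.Basis (Fin n) K⟦X⟧ (U.piece k))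
  (hX : ∀ (n : ℕ), ∀ m ∈ U.piece (k - n),
        ∃ m' ∈ U.piece k, m = (PowerSeries.X : K⟦X⟧) ^ n • m')
include hX

theorem linearIndependent_toGr [Module.IsTorsionFree K⟦X⟧ (U.piece k)] :
    LinearIndependent K[X] fun i => U.toGr k (b i) := by
  rw [Fintype.linearIndependent_iff]
  intro p hp i
  ext l
  have h := congrArg (U.grComponent (k - l)) hp
  simp_rw [map_sum, grComponent_smul_toGr, map_zero] at h
  rw [← map_sum, ← map_sum, toGrPiece_eq_zero_iff, coe_mulXPow, sub_sub] at h
  -- the `l`-th coefficients give `x ^ l ∑ cᵢ uᵢ ∈ U_{k-l-1} = x ^ (l+1) U_k`, so `x ∣ cᵢ`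
  obtain ⟨m', hm', h⟩ := hX (l + 1) _ (by push_cast; exact h)
  rw [pow_succ, mul_smul] at h
  have h' := smul_right_injective (U.piece k) (pow_ne_zero l (PowerSeries.X_ne_zero (R := K)))
    (a₁ := ∑ i, (PowerSeries.C ((p i).coeff l) : K⟦X⟧) • b i)
    (a₂ := (PowerSeries.X : K⟦X⟧) • ⟨m', hm'⟩) (Subtype.ext h)
  have h'' := congrArg (fun w => PowerSeries.constantCoeff (b.repr w i)) h'
  simp only [b.repr_sum_self, map_smul] at h''
  simpa using h''

theorem exists_X_pow_smul_mem_span_toGr (g : U.Gr) :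
    ∃ l : ℕ, (Polynomial.X ^ l : K[X]) • g ∈
      Submodule.span K[X] (Set.range fun i => U.toGr k (b i)) := by
  set S := Submodule.span K[X] (Set.range fun i => U.toGr k (b i))
  -- on `gr_k M`, a power series acts through its constant term
  have hsmul : ∀ (f : K⟦X⟧) (m : U.piece k),
      U.toGr k (f • m) = (Polynomial.C (PowerSeries.constantCoeff f) : K[X]) • U.toGr k m := by
    intro f m
    obtain ⟨q, hq⟩ := PowerSeries.X_dvd_iff.2
      (show PowerSeries.constantCoeff (f - PowerSeries.C (PowerSeries.constantCoeff f)) = 0 by simp)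
    have hXq : U.toGr k ((PowerSeries.X : K⟦X⟧) • q • m) = 0 := by
      refine U.toGr_eq_zero ?_
      have := U.X_pow_smul_mem (q • m).2 1
      rwa [pow_one] at this
    rw [C_smul_gr, ← map_smul]
    conv_lhs => rw [sub_eq_iff_eq_add'.1 hq, add_smul, map_add, mul_smul, hXq, add_zero]
  have hk : ∀ m : U.piece k, U.toGr k m ∈ S := by
    intro m
    rw [← b.sum_repr m, map_sum]
    refine S.sum_mem fun i _ => ?_
    rw [hsmul]
    exact S.smul_mem _ (Submodule.subset_span ⟨i, rfl⟩)
  have hlow : ∀ (l : ℕ) (m : U.piece (k - l)), U.toGr (k - l) m ∈ S := by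
    intro l m
    obtain ⟨m', hm', h⟩ := hX l m m.2
    have : U.toGr (k - l) m = (Polynomial.X ^ l : K[X]) • U.toGr k ⟨m', hm'⟩ := by
      rw [X_pow_smul_toGr]
      exact U.toGr_congr rfl h
    rw [this]
    exact S.smul_mem _ (hk _)
  induction g using gr_induction with
  | zero => exact ⟨0, by rw [smul_zero]; exact S.zero_mem⟩
  | of j m =>
    refine ⟨(j - k).toNat, ?_⟩
    have h := U.X_pow_smul_toGr (j - k).toNat m
    have h' : U.toGr _ (U.mulXPow j (j - k).toNat m) =
        U.toGr (k - (k - j).toNat) ⟨_, by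
          convert (U.mulXPow j (j - k).toNat m).2 using 2; omega⟩ :=
      U.toGr_congr (by omega) rfl
    rw [h'] at h
    exact h ▸ hlow _ _
  | add g g' hg hg' =>
    obtain ⟨l, hl⟩ := hg
    obtain ⟨l', hl'⟩ := hg'
    refine ⟨l + l', ?_⟩
    rw [smul_add, pow_add, mul_smul, mul_smul, smul_comm (Polynomial.X ^ l) _ g]
    exact S.add_mem (S.smul_mem _ hl) (S.smul_mem _ hl')

end ModuleFiltration

open ModuleFiltration

theorem grRank_eq_rank [CharZero K] (reg : IsRegular K M) (U : ModuleFiltration (V K) M)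
    (hU : U.IsGood) : U.grRank = rank K M := by
  obtain ⟨k, hfg, hfree, hX⟩ := hU.exists_fg_torsionFree reg
  have : Module.Finite K⟦X⟧ (U.piece k) := Module.Finite.iff_fg.2 hfg
  let b := Module.finBasis K⟦X⟧ (U.piece k)
  rw [grRank, rank, rank_tensor_eq_of_linearIndependent (RatFunc K) (linearIndependent_toGr b hX),
    rank_tensor_eq_of_linearIndependent K⸨X⸩
      (b.linearIndependent.map' (U.piece k).subtype (Submodule.ker_subtype _))]
  · intro m
    obtain ⟨j, hj⟩ := U.exhaustive m
    refine ⟨PowerSeries.X ^ (j - k).toNat, pow_ne_zero _ PowerSeries.X_ne_zero, ?_⟩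
    rw [Set.range_comp, ← Submodule.map_span, b.span_eq, Submodule.map_top, Submodule.range_subtype]
    exact U.mono (by omega) (U.X_pow_smul_mem hj _)
  · intro g
    obtain ⟨l, hl⟩ := exists_X_pow_smul_mem_span_toGr b hX g
    exact ⟨_, pow_ne_zero l Polynomial.X_ne_zero, hl⟩

end FormalWeyl

end

theorem mainTheorem8 {M : Type*} [AddCommGroup M] [Module (FormalWeyl.WeylHat ℂ) M]
    (hol : FormalWeyl.IsHolonomic ℂ M) (reg : FormalWeyl.IsRegular ℂ M)
    (U : FormalWeyl.ModuleFiltration (FormalWeyl.V ℂ) M) (hU : U.IsGood) :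
    U.grRank = FormalWeyl.rank ℂ M :=
  FormalWeyl.grRank_eq_rank reg U hU
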